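/- For every $\Lambda>0$ there is $\delta>0$, depending only on $\Lambda$, with the following property. Let $\varepsilon:\mathbb R^2\to\mathbb R$ be a continuous positive function that is $\mathbb Z^2$-periodic, i.e. $\varepsilon(x+n)=\varepsilon(x)$ for all $x\in\mathbb R^2$, $n\in\mathbb Z^2$, and suppose that $|\varepsilon(x)-1|<\delta$ for all $x\in\mathbb R^2$. Then for every real $\lambda$ with $0\le\lambda\le\Lambda$ there is a bounded, not identically zero, continuous function $E:\mathbb R^2\to\mathbb C$ that solves $$-\Delta E=\lambda\,\varepsilon\,E\quad\text{on }\mathbb R^2$$ in the sense of distributions, that is, $-\int_{\mathbb R^2}E\,\Delta\varphi\,dx=\lambda\int_{\mathbb R^2}\varepsilon\,E\,\varphi\,dx$ for every $\varphi\in C_c^\infty(\mathbb R^2;\mathbb C)$. -/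

import Mathlib

open scoped ContDiff Laplacian
open MeasureTheory

/-- The Euclidean plane `ℝ²`. -/
abbrev Plane : Type := EuclideanSpace ℝ (Fin 2)

/-- `f(x + n) = f(x)` for all `x ∈ ℝ²` and `n ∈ ℤ²`. -/
def IsZ2Periodic (f : Plane → ℝ) : Prop :=
  ∀ (n : Fin 2 → ℤ) (x : Plane), f (x + WithLp.toLp 2 (fun i => (n i : ℝ))) = f x

/-- `E` solves `-ΔE = lam · ε · E` on `ℝ²` in the sense of distributions: `E` is locally integrable
and `-∫ E Δφ = lam ∫ ε E φ` for every complex-valued smooth compactly supported `φ`. -/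
def IsDistributionalSolution (ε : Plane → ℝ) (lam : ℝ) (E : Plane → ℂ) : Prop :=
  LocallyIntegrable E volume ∧
    ∀ φ : Plane → ℂ, ContDiff ℝ ∞ φ → HasCompactSupport φ →
      -∫ x, E x * Δ φ x = (lam : ℂ) * ∫ x, (ε x : ℂ) * E x * φ x

/-! Write `ε = 1 + V`, `r = √lam`, and seek a Bloch wave `E = exp(iθ·x) w` with `w` periodic of mean
one and `θ = s r e`, where `e` is a unit vector and `s` is near 1. In Fourier modes the equation
reads `(|θ + 2πn|² - lam) wₙ = lam (V w)ₙ`, and it is solved by Lyapunov–Schmidt reduction.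

For `n ≠ 0`, a suitable direction `e` keeps the factor on the left at least `c|n|²`, uniformly in
`r` and `s` (`exists_dispersion_gap`). Its inverse is square-summable in dimension two, so it
defines a bounded multiplier on continuous functions, and for small `V` a Neumann series gives `w`.

For `n = 0` there remains `s² - 1 = (V w)₀`. Hermitian symmetry makes the right side real
(`im_mean_eq_zero`), so the intermediate value theorem yields `s` (`exists_solution_with_mean`).
`isDistributionalSolution_bloch` returns to the plane. -/

/-- The squared Euclidean length of an integer vector. -/
def latticeNormSq (n : Fin 2 → ℤ) : ℝ := (n 0 : ℝ) ^ 2 + (n 1 : ℝ) ^ 2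

/-! ### Non-resonant directions -/

lemma latticeNormSq_nonneg (n : Fin 2 → ℤ) : 0 ≤ latticeNormSq n := by
  unfold latticeNormSq; positivity

lemma one_le_latticeNormSq {n : Fin 2 → ℤ} (hn : n ≠ 0) : 1 ≤ latticeNormSq n := by
  have h : 0 < n 0 ^ 2 + n 1 ^ 2 := by
    by_contra! h
    apply hn
    funext i
    have h0 : n 0 = 0 := by nlinarith [sq_nonneg (n 0), sq_nonneg (n 1)]
    have h1 : n 1 = 0 := by nlinarith [sq_nonneg (n 0), sq_nonneg (n 1)]
    fin_cases i <;> simpa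
  have : (1 : ℤ) ≤ n 0 ^ 2 + n 1 ^ 2 := h
  unfold latticeNormSq
  exact_mod_cast this

/-- Cauchy–Schwarz for a unit vector of the plane. -/
lemma sq_dot_le_latticeNormSq {a b : ℝ} (hab : a ^ 2 + b ^ 2 = 1) (n : Fin 2 → ℤ) :
    (a * n 0 + b * n 1) ^ 2 ≤ latticeNormSq n := by
  unfold latticeNormSq
  have : (n 0 : ℝ) ^ 2 + (n 1 : ℝ) ^ 2 - (a * n 0 + b * n 1) ^ 2 = (a * n 1 - b * n 0) ^ 2 := by
    linear_combination (-(n 0 : ℝ) ^ 2 - (n 1 : ℝ) ^ 2) * hab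
  nlinarith [sq_nonneg (a * n 1 - b * n 0)]

/-- Integrality gives `|n| ≤ |n|²`, so perturbations linear in `n` are absorbed by a gap quadratic
in `n`. -/
lemma abs_dot_le_latticeNormSq {a b : ℝ} (hab : a ^ 2 + b ^ 2 = 1) (n : Fin 2 → ℤ) :
    |a * n 0 + b * n 1| ≤ latticeNormSq n := by
  rcases eq_or_ne n 0 with rfl | hn
  · simp [latticeNormSq]
  · apply abs_le_of_sq_le_sq _ (latticeNormSq_nonneg n)
    nlinarith [sq_dot_le_latticeNormSq hab n, one_le_latticeNormSq hn]

/-- Some unit vector avoids the finitely many lines attached to a finite set of lattice points. -/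
lemma exists_unit_vector_avoiding (r : ℝ) (S : Finset (Fin 2 → ℤ)) (hS : 0 ∉ S) :
    ∃ a b : ℝ, a ^ 2 + b ^ 2 = 1 ∧
      ∀ n ∈ S, r * (a * n 0 + b * n 1) + Real.pi * latticeNormSq n ≠ 0 := by
  -- The rational parametrization of the circle, with the denominator `1 + t²` cleared.
  let p : (Fin 2 → ℤ) → Polynomial ℝ := fun n =>
    Polynomial.C (Real.pi * latticeNormSq n - r * n 0) * Polynomial.X ^ 2 +
      Polynomial.C (2 * r * n 1) * Polynomial.X +
      Polynomial.C (Real.pi * latticeNormSq n + r * n 0)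
  have hp : ∏ n ∈ S, p n ≠ 0 := by
    rw [Finset.prod_ne_zero_iff]
    intro n hn h0
    have hne : n ≠ 0 := fun h => hS (h ▸ hn)
    -- The values at `1` and `-1` add up to `4π|n|² > 0`.
    have h1 := congrArg (Polynomial.eval 1) h0
    have h2 := congrArg (Polynomial.eval (-1)) h0
    have h3 := congrArg (Polynomial.eval 0) h0
    simp [p] at h1 h2 h3
    have := mul_pos Real.pi_pos (zero_lt_one.trans_le (one_le_latticeNormSq hne))
    linarith
  obtain ⟨t, ht⟩ := Polynomial.exists_eval_ne_zero_of_natDegree_lt_card (∏ n ∈ S, p n) hp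
    ((Cardinal.natCast_lt_aleph0).trans_le (Cardinal.aleph0_le_mk ℝ))
  have hpos : 0 < 1 + t ^ 2 := by positivity
  refine ⟨(1 - t ^ 2) / (1 + t ^ 2), 2 * t / (1 + t ^ 2), by field_simp; ring, ?_⟩
  intro n hn h0
  rw [Polynomial.eval_prod, Finset.prod_ne_zero_iff] at ht
  apply ht n hn
  simp only [p, Polynomial.eval_add, Polynomial.eval_mul, Polynomial.eval_C, Polynomial.eval_pow,
    Polynomial.eval_X]
  field_simp at h0
  linear_combination h0

lemma le_latticeNormSq_of_notMem_Icc {M : ℕ} {n : Fin 2 → ℤ}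
    (hn : n ∉ Finset.Icc (fun _ => -(M : ℤ)) (fun _ => (M : ℤ))) :
    (M : ℝ) ^ 2 ≤ latticeNormSq n := by
  by_contra! h
  apply hn
  have h' : n 0 ^ 2 + n 1 ^ 2 < (M : ℤ) ^ 2 := by
    unfold latticeNormSq at h
    exact_mod_cast h
  have key : ∀ i, |n i| ≤ M := by
    intro i
    apply abs_le_of_sq_le_sq _ (by positivity)
    fin_cases i <;> simp <;> nlinarith [sq_nonneg (n 0), sq_nonneg (n 1)]
  rw [Finset.mem_Icc]
  exact ⟨fun i => (abs_le.mp (key i)).1, fun i => (abs_le.mp (key i)).2⟩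

/-- Outside a box of half-width `M ≥ R` one has `|r e·n| ≤ M|n| ≤ |n|²`, which `π|n|²` beats for
every direction. The finitely many remaining `n` are handled by the choice of direction. -/
lemma exists_gap_at {R r : ℝ} (hr : |r| ≤ R) :
    ∃ c > 0, ∃ a b : ℝ, a ^ 2 + b ^ 2 = 1 ∧ ∀ n : Fin 2 → ℤ,
      c * latticeNormSq n ≤ |r * (a * n 0 + b * n 1) + Real.pi * latticeNormSq n| := by
  obtain ⟨M, hM⟩ := exists_nat_ge R
  let S := (Finset.Icc (fun _ : Fin 2 => -(M : ℤ)) (fun _ => (M : ℤ))).erase 0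
  obtain ⟨a, b, hab, h⟩ := exists_unit_vector_avoiding r S (by simp [S])
  have hfin : ∃ c > 0, ∀ n ∈ S,
      c ≤ |r * (a * n 0 + b * n 1) + Real.pi * latticeNormSq n| / latticeNormSq n := by
    rcases S.eq_empty_or_nonempty with hS | hS
    · exact ⟨1, one_pos, by simp [hS]⟩
    · obtain ⟨m, hm, hmin⟩ := S.exists_min_image
        (fun n => |r * (a * n 0 + b * n 1) + Real.pi * latticeNormSq n| / latticeNormSq n) hS
      refine ⟨_, ?_, hmin⟩
      have hm0 : m ≠ 0 := (Finset.mem_erase.mp hm).1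
      exact div_pos (abs_pos.mpr (h m hm)) (zero_lt_one.trans_le (one_le_latticeNormSq hm0))
  obtain ⟨c, hc, hcS⟩ := hfin
  refine ⟨min c 1, lt_min hc one_pos, a, b, hab, fun n => ?_⟩
  rcases eq_or_ne n 0 with rfl | hn
  · simp [latticeNormSq]
  have hq := one_le_latticeNormSq hn
  by_cases hnS : n ∈ S
  · have := (le_div_iff₀ (by linarith)).mp (hcS n hnS)
    exact (mul_le_mul_of_nonneg_right (min_le_left c 1) (by linarith)).trans this
  · have hM' : (M : ℝ) ^ 2 ≤ latticeNormSq n := by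
      apply le_latticeNormSq_of_notMem_Icc
      simpa [S, hn] using hnS
    have hle : |r * (a * n 0 + b * n 1)| ≤ latticeNormSq n := by
      apply abs_le_of_sq_le_sq _ (by linarith)
      have h1 := sq_dot_le_latticeNormSq hab n
      have h2 : r ^ 2 ≤ (M : ℝ) ^ 2 := by
        rw [← sq_abs r]; exact pow_le_pow_left₀ (abs_nonneg _) (hr.trans hM) 2
      rw [mul_pow]
      calc _ ≤ (M : ℝ) ^ 2 * latticeNormSq n := by gcongr
        _ ≤ _ := by rw [sq (latticeNormSq n)]; gcongr
    have h3 := Real.pi_gt_three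
    have h4 := (abs_le.mp hle).1
    calc min c 1 * latticeNormSq n ≤ 1 * latticeNormSq n := by gcongr; exact min_le_right _ _
      _ ≤ r * (a * n 0 + b * n 1) + Real.pi * latticeNormSq n := by nlinarith
      _ ≤ _ := le_abs_self _

/-- The gap can be chosen uniformly in the radius. -/
lemma exists_uniform_gap (R : ℝ) :
    ∃ c > 0, ∀ r ∈ Set.Icc 0 R, ∃ a b : ℝ, a ^ 2 + b ^ 2 = 1 ∧ ∀ n : Fin 2 → ℤ,
      c * latticeNormSq n ≤ |r * (a * n 0 + b * n 1) + Real.pi * latticeNormSq n| := by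
  refine isCompact_Icc.induction_on (p := fun s => ∃ c > 0, ∀ r ∈ s, ∃ a b : ℝ,
    a ^ 2 + b ^ 2 = 1 ∧ ∀ n : Fin 2 → ℤ,
      c * latticeNormSq n ≤ |r * (a * n 0 + b * n 1) + Real.pi * latticeNormSq n|)
    ⟨1, one_pos, by simp⟩ ?_ ?_ ?_
  · rintro s t hst ⟨c, hc, h⟩
    exact ⟨c, hc, fun r hr => h r (hst hr)⟩
  · rintro s t ⟨c, hc, h⟩ ⟨d, hd, h'⟩
    refine ⟨min c d, lt_min hc hd, fun r hr => ?_⟩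
    rcases hr with hr | hr
    · obtain ⟨a, b, hab, h⟩ := h r hr
      exact ⟨a, b, hab, fun n => (mul_le_mul_of_nonneg_right (min_le_left _ _)
        (latticeNormSq_nonneg n)).trans (h n)⟩
    · obtain ⟨a, b, hab, h⟩ := h' r hr
      exact ⟨a, b, hab, fun n => (mul_le_mul_of_nonneg_right (min_le_right _ _)
        (latticeNormSq_nonneg n)).trans (h n)⟩
  · intro r hr
    obtain ⟨c, hc, a, b, hab, h⟩ := exists_gap_at (R := R) (r := r)
      (by rw [abs_of_nonneg hr.1]; exact hr.2)
    -- The direction found for `r` still works nearby, at the cost of half the gap.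
    refine ⟨Metric.ball r (c / 2),
      mem_nhdsWithin_of_mem_nhds (Metric.ball_mem_nhds _ (by positivity)),
      c / 2, by positivity, fun r' hr' => ⟨a, b, hab, fun n => ?_⟩⟩
    rw [Metric.mem_ball, dist_comm, Real.dist_eq] at hr'
    have h1 := h n
    have h2 : |(r - r') * (a * n 0 + b * n 1)| ≤ c / 2 * latticeNormSq n := by
      rw [abs_mul]
      exact mul_le_mul hr'.le (abs_dot_le_latticeNormSq hab n) (abs_nonneg _) (by positivity)
    have h3 := abs_add_le (r' * (a * n 0 + b * n 1) + Real.pi * latticeNormSq n)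
      ((r - r') * (a * n 0 + b * n 1))
    have h4 : r' * (a * n 0 + b * n 1) + Real.pi * latticeNormSq n
      + (r - r') * (a * n 0 + b * n 1) = r * (a * n 0 + b * n 1) + Real.pi * latticeNormSq n := by
      ring
    rw [h4] at h3
    linarith

/-! ### The dispersion relation near `s = 1` -/

/-- `|s r e + 2πn|² - r²` for the unit vector `e = (a, b)`. -/
noncomputable def dispersion (a b r s : ℝ) (n : Fin 2 → ℤ) : ℝ :=
  (s ^ 2 - 1) * r ^ 2 + 4 * Real.pi * (s * r * (a * n 0 + b * n 1) + Real.pi * latticeNormSq n)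

lemma abs_dispersion_sub_le {a b r R s t : ℝ} (hab : a ^ 2 + b ^ 2 = 1) (hr : r ∈ Set.Icc 0 R)
    (hs : |s| ≤ 2) (ht : |t| ≤ 2) {n : Fin 2 → ℤ} (hn : n ≠ 0) :
    |dispersion a b r s n - dispersion a b r t n| ≤
      (4 * R ^ 2 + 4 * Real.pi * R) * |s - t| * latticeNormSq n := by
  have hR : 0 ≤ R := hr.1.trans hr.2
  have hq := one_le_latticeNormSq hn
  have e : dispersion a b r s n - dispersion a b r t n =
      (s - t) * ((s + t) * r ^ 2 + 4 * Real.pi * r * (a * n 0 + b * n 1)) := by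
    unfold dispersion; ring
  have h1 : |(s + t) * r ^ 2| ≤ 4 * R ^ 2 * latticeNormSq n := by
    rw [abs_mul, abs_of_nonneg (sq_nonneg r)]
    have : |s + t| ≤ 4 := (abs_add_le s t).trans (by linarith)
    have h2 : r ^ 2 ≤ R ^ 2 := pow_le_pow_left₀ hr.1 hr.2 2
    calc |s + t| * r ^ 2 ≤ 4 * R ^ 2 := by gcongr
      _ ≤ _ := le_mul_of_one_le_right (by positivity) hq
  have h2 : |4 * Real.pi * r * (a * n 0 + b * n 1)| ≤ 4 * Real.pi * R * latticeNormSq n := by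
    have := Real.pi_pos
    rw [abs_mul, abs_of_nonneg (mul_nonneg (by positivity) hr.1)]
    have := abs_dot_le_latticeNormSq hab n
    have := hr.2
    gcongr
  rw [e, abs_mul]
  calc _ ≤ |s - t| * (4 * R ^ 2 * latticeNormSq n + 4 * Real.pi * R * latticeNormSq n) := by
        gcongr; exact (abs_add_le _ _).trans (add_le_add h1 h2)
    _ = _ := by ring

lemma exists_dispersion_gap {R : ℝ} (hR : 0 ≤ R) :
    ∃ c > 0, ∃ τ > 0, τ ≤ 1 ∧ ∀ r ∈ Set.Icc 0 R, ∃ a b : ℝ, a ^ 2 + b ^ 2 = 1 ∧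
      ∀ s, |s - 1| ≤ τ → ∀ n : Fin 2 → ℤ, c * latticeNormSq n ≤ |dispersion a b r s n| := by
  obtain ⟨c, hc, h⟩ := exists_uniform_gap R
  have hpi := Real.pi_gt_three
  set L := 4 * R ^ 2 + 4 * Real.pi * R with hL
  have hL0 : 0 ≤ L := by positivity
  -- At `s = 1` the gap is `4πc|n|²`, and this `τ` makes the loss at most `c|n|²`. The `+ 1` covers
  -- `L = 0`.
  refine ⟨c, hc, min 1 (c / (L + 1)), by positivity, min_le_left _ _, fun r hr => ?_⟩
  obtain ⟨a, b, hab, h⟩ := h r hr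
  refine ⟨a, b, hab, fun s hs n => ?_⟩
  rcases eq_or_ne n 0 with rfl | hn
  · simp [latticeNormSq]
  have hq := one_le_latticeNormSq hn
  have hs1 : |s - 1| ≤ 1 := hs.trans (min_le_left _ _)
  have hs2 : |s - 1| ≤ c / (L + 1) := hs.trans (min_le_right _ _)
  have hs3 : |s| ≤ 2 := by
    rw [abs_le] at hs1 ⊢; constructor <;> linarith
  have h1 := abs_dispersion_sub_le hab hr (t := 1) hs3 (by norm_num) hn
  have h2 : |dispersion a b r 1 n| ≥ 4 * Real.pi * (c * latticeNormSq n) := by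
    have : dispersion a b r 1 n =
        4 * Real.pi * (r * (a * n 0 + b * n 1) + Real.pi * latticeNormSq n) := by
      unfold dispersion; ring
    rw [this, abs_mul, abs_of_pos (by positivity)]
    exact mul_le_mul_of_nonneg_left (h n) (by positivity)
  have h3 : L * |s - 1| ≤ c := by
    rw [le_div_iff₀ (by positivity)] at hs2
    nlinarith [abs_nonneg (s - 1)]
  have h4 : L * |s - 1| * latticeNormSq n ≤ c * latticeNormSq n := by gcongr
  have h5 := abs_sub_abs_le_abs_sub (dispersion a b r 1 n) (dispersion a b r s n)
  rw [abs_sub_comm (dispersion a b r 1 n)] at h5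
  nlinarith [mul_pos hc (zero_lt_one.trans_le hq)]

/-- Comparison with the sup norm to the power `-4`; the exponent exceeds the dimension 2. -/
lemma summable_inv_latticeNormSq_sq :
    Summable fun n : Fin 2 → ℤ => ((latticeNormSq n)⁻¹) ^ 2 := by
  refine Summable.of_nonneg_of_le (fun n => by positivity) (fun n => ?_)
    (EisensteinSeries.summable_one_div_norm_rpow (k := 4) (by norm_num))
  rcases eq_or_ne n 0 with rfl | hn
  · simp [latticeNormSq]
  · have h : ‖n‖ ^ 2 ≤ latticeNormSq n := by
      have : ‖n‖ ≤ √(latticeNormSq n) := by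
        rw [pi_norm_le_iff_of_nonneg (Real.sqrt_nonneg _)]
        intro i
        apply Real.le_sqrt_of_sq_le
        rw [Int.norm_eq_abs, sq_abs]
        unfold latticeNormSq
        fin_cases i <;> simp <;> positivity
      calc ‖n‖ ^ 2 ≤ √(latticeNormSq n) ^ 2 := by gcongr
        _ = _ := Real.sq_sqrt (latticeNormSq_nonneg n)
    have hn' : 0 < ‖n‖ := norm_pos_iff.mpr hn
    rw [Real.rpow_neg hn'.le]
    have : ‖n‖ ^ (4 : ℝ) = (‖n‖ ^ 2) ^ 2 := by
      rw [← pow_mul]; exact_mod_cast Real.rpow_natCast ‖n‖ 4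
    rw [this, inv_pow]
    gcongr

/-! ### Multipliers with square-summable symbol and the reduced equation -/

noncomputable section FourierMultipliers

variable {X ι : Type*} [TopologicalSpace X] [CompactSpace X] [MeasurableSpace X] [BorelSpace X]
  {μ : Measure X} [IsProbabilityMeasure μ]

/-- A family of continuous functions of norm one that forms a Hilbert basis of `L²(μ)`. -/
structure ContinuousHilbertBasis (ι : Type*) (μ : Measure X) [IsProbabilityMeasure μ] where
  /-- The functions of the family. -/
  fn : ι → C(X, ℂ)
  /-- The Hilbert basis formed by their classes. -/
  basis : HilbertBasis ι ℂ (Lp ℂ 2 μ)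
  basis_eq : ∀ n, basis n = ContinuousMap.toLp 2 μ ℂ (fn n)
  norm_fn : ∀ n, ‖fn n‖ = 1

/-- Square-summable complex families. -/
abbrev SquareSummable (ι : Type*) : Type _ := lp (fun _ : ι => ℂ) 2

namespace ContinuousHilbertBasis

variable (e : ContinuousHilbertBasis ι μ)

/-- The coefficients of a continuous function in the basis. -/
def coeffs : C(X, ℂ) →L[ℂ] SquareSummable ι :=
  e.basis.repr.toContinuousLinearEquiv.toContinuousLinearMap ∘L
    ContinuousMap.toLp 2 μ ℂ

lemma coeffs_apply (f : C(X, ℂ)) :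
    e.coeffs f = e.basis.repr (ContinuousMap.toLp 2 μ ℂ f) := rfl

lemma norm_coeffs_le (f : C(X, ℂ)) : ‖e.coeffs f‖ ≤ ‖f‖ := by
  rw [e.coeffs_apply, LinearIsometryEquiv.norm_map]
  refine (ContinuousLinearMap.le_opNorm _ f).trans ?_
  refine mul_le_of_le_one_left (norm_nonneg _) ((ContinuousMap.toLp_norm_le _).trans ?_)
  simp [measureUnivNNReal]

lemma squareSummable_summable_and_le (a b : SquareSummable ι) :
    (Summable fun n => ‖a n‖ * ‖b n‖) ∧ ∑' n, ‖a n‖ * ‖b n‖ ≤ ‖a‖ * ‖b‖ :=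
  lp.tsum_mul_le_mul_norm (by simpa using Real.HolderConjugate.two_two) a b

lemma norm_product_term (a b : SquareSummable ι) (n : ι) :
    ‖(a n * b n) • e.fn n‖ = ‖a n‖ * ‖b n‖ := by
  rw [norm_smul, e.norm_fn, mul_one, norm_mul]

lemma inner_toLp_eq_inner_coeffs (f g : C(X, ℂ)) :
    inner ℂ (ContinuousMap.toLp (E := ℂ) 2 μ ℂ f) (ContinuousMap.toLp (E := ℂ) 2 μ ℂ g) =
      inner ℂ (e.coeffs f) (e.coeffs g) := by
  rw [e.coeffs_apply, e.coeffs_apply, LinearIsometryEquiv.inner_map_map]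

lemma summable_product_series (a b : SquareSummable ι) :
    Summable fun n => (a n * b n) • (e.fn n : C(X, ℂ)) := by
  refine .of_norm ?_
  simp_rw [e.norm_product_term]
  exact (squareSummable_summable_and_le a b).1

/-- The continuous function with coefficients `aₙ bₙ`, for square-summable `a` and `b`. -/
def productSeries : SquareSummable ι →L[ℂ] SquareSummable ι →L[ℂ] C(X, ℂ) :=
  LinearMap.mkContinuous₂
    (LinearMap.mk₂ ℂ (fun a b => ∑' n, (a n * b n) • e.fn n)
      (fun a a' b => by
        rw [← (e.summable_product_series a b).tsum_add (e.summable_product_series a' b)]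
        exact tsum_congr fun n => by rw [lp.coeFn_add, Pi.add_apply, add_mul]; exact add_smul _ _ _)
      (fun c a b => by
        rw [← (e.summable_product_series a b).tsum_const_smul]
        simp [mul_assoc, smul_smul])
      (fun a b b' => by
        rw [← (e.summable_product_series a b).tsum_add (e.summable_product_series a b')]
        exact tsum_congr fun n => by rw [lp.coeFn_add, Pi.add_apply, mul_add]; exact add_smul _ _ _)
      (fun c a b => by
        rw [← (e.summable_product_series a b).tsum_const_smul]
        simp [mul_left_comm, smul_smul]))
    1 (fun a b => by
      rw [one_mul]
      refine (tsum_of_norm_bounded (squareSummable_summable_and_le a b).1.hasSum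
        fun n => (e.norm_product_term a b n).le).trans (squareSummable_summable_and_le a b).2)

lemma productSeries_apply (a b : SquareSummable ι) :
    e.productSeries a b = ∑' n, (a n * b n) • e.fn n := rfl

lemma norm_productSeries_le (a b : SquareSummable ι) : ‖e.productSeries a b‖ ≤ ‖a‖ * ‖b‖ :=
  (tsum_of_norm_bounded (squareSummable_summable_and_le a b).1.hasSum
    fun n => (e.norm_product_term a b n).le).trans (squareSummable_summable_and_le a b).2

/-- The multiplier operator on `C(X)` with square-summable symbol `a`. -/
def multiplier (a : SquareSummable ι) : C(X, ℂ) →L[ℂ] C(X, ℂ) :=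
  e.productSeries a ∘L e.coeffs

lemma continuous_multiplier : Continuous e.multiplier := by
  unfold multiplier
  fun_prop

/-- By Cauchy–Schwarz the coefficients `aₙ fₙ` are absolutely summable, so the series converges in
sup norm. -/
lemma norm_multiplier_apply_le (a : SquareSummable ι) (f : C(X, ℂ)) :
    ‖e.multiplier a f‖ ≤ ‖a‖ * ‖f‖ :=
  (e.norm_productSeries_le a _).trans (by gcongr; exact e.norm_coeffs_le f)

lemma im_inner_mul_self {V : C(X, ℂ)} (hV : ∀ x : X, (V x).im = 0)
    (w : C(X, ℂ)) :
    (inner ℂ (e.coeffs w) (e.coeffs (V * w))).im = 0 := by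
  rw [← e.inner_toLp_eq_inner_coeffs, ContinuousMap.inner_toLp]
  have : ∀ x, (V * w) x * (starRingEnd ℂ) (w x) = (((V x).re * Complex.normSq (w x) : ℝ) : ℂ) := by
    intro x
    rw [ContinuousMap.mul_apply, mul_assoc, Complex.mul_conj]
    apply Complex.ext <;> simp [hV x]
  simp_rw [this]
  rw [integral_complex_ofReal, Complex.ofReal_im]

lemma norm_solution_le_two [Nonempty X] {a : SquareSummable ι} {V : C(X, ℂ)} {lam : ℝ}
    (h : |lam| * ‖a‖ * ‖V‖ ≤ 1 / 2)
    {w : C(X, ℂ)} (hw : w = 1 + (lam : ℂ) • e.multiplier a (V * w)) :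
    ‖w‖ ≤ 2 := by
  have h1 : ‖w‖ ≤ 1 + |lam| * (‖a‖ * (‖V‖ * ‖w‖)) := by
    calc ‖w‖ = ‖1 + (lam : ℂ) • e.multiplier a (V * w)‖ := by rw [← hw]
      _ ≤ ‖(1 : C(X, ℂ))‖ + ‖(lam : ℂ) • e.multiplier a (V * w)‖ :=
        norm_add_le _ _
      _ ≤ _ := by
        rw [norm_one, norm_smul, Complex.norm_real, Real.norm_eq_abs]
        gcongr
        exact (e.norm_multiplier_apply_le a _).trans (by gcongr; exact norm_mul_le _ _)
  nlinarith [mul_le_mul_of_nonneg_right h (norm_nonneg w)]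

variable [DecidableEq ι]

lemma coeffs_fn (m : ι) :
    e.coeffs (e.fn m) = lp.single 2 m (1 : ℂ) := by
  have h : ContinuousMap.toLp 2 μ ℂ (e.fn m) = e.basis m := by
    rw [e.basis_eq]
  rw [e.coeffs_apply, h]
  exact HilbertBasis.repr_self _ m

lemma coeffs_fn_apply (m n : ι) :
    e.coeffs (e.fn m) n = if n = m then 1 else 0 := by
  rw [e.coeffs_fn, lp.single_apply]
  simp [Pi.single_apply]

lemma multiplier_fn (a : SquareSummable ι) (m : ι) :
    e.multiplier a (e.fn m) = a m • e.fn m := by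
  change e.productSeries a (e.coeffs (e.fn m)) = _
  rw [e.productSeries_apply, tsum_eq_single m]
  · simp [e.coeffs_fn_apply]
  · intro n hn
    rw [e.coeffs_fn_apply, if_neg hn, mul_zero]
    exact zero_smul ℂ _

lemma coeffs_multiplier (a : SquareSummable ι) (f : C(X, ℂ))
    (m : ι) : e.coeffs (e.multiplier a f) m = a m * e.coeffs f m := by
  have h1 := (e.summable_product_series a (e.coeffs f)).hasSum
  have h2 := (h1.mapL e.coeffs).mapL (lp.evalCLM ℂ (fun _ : ι => ℂ) 2 m)
  have h3 : HasSum (fun n => (lp.evalCLM ℂ (fun _ : ι => ℂ) 2 m)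
      (e.coeffs ((a n * e.coeffs f n) • e.fn n))) (a m * e.coeffs f m) := by
    convert hasSum_ite_eq m (a m * e.coeffs f m) using 2 with n
    change e.coeffs ((a n * e.coeffs f n) • e.fn n) m = _
    rw [map_smul, lp.coeFn_smul, Pi.smul_apply, e.coeffs_fn_apply]
    by_cases h : n = m
    · simp [h]
    · simp [h, Ne.symm h]
  exact h2.unique h3

lemma im_inner_multiplier {a : SquareSummable ι} (ha : ∀ n, (a n).im = 0)
    (f : C(X, ℂ)) :
    (inner ℂ (e.coeffs (e.multiplier a f)) (e.coeffs f)).im = 0 := by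
  have h := lp.hasSum_inner (𝕜 := ℂ) (e.coeffs (e.multiplier a f)) (e.coeffs f)
  have h2 := Complex.hasSum_im h
  refine h2.unique ?_
  convert hasSum_zero with n
  rw [e.coeffs_multiplier]
  simp [ha n]
  ring

lemma coeffs_eq_inner {o : ι} (ho : e.fn o = 1) (f : C(X, ℂ)) :
    e.coeffs f o = inner ℂ (e.coeffs 1) (e.coeffs f) := by
  rw [← ho, e.coeffs_fn, lp.inner_single_left]
  simp

/-- The mean of `V w` is real when `w` solves a Hermitian equation. -/
lemma im_mean_eq_zero {o : ι} (ho : e.fn o = 1) {a : SquareSummable ι} (ha : ∀ n, (a n).im = 0)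
    {V : C(X, ℂ)} (hV : ∀ x : X, (V x).im = 0) {lam : ℝ}
    {w : C(X, ℂ)} (hw : w = 1 + (lam : ℂ) • e.multiplier a (V * w)) :
    (e.coeffs (V * w) o).im = 0 := by
  have h1 := e.im_inner_mul_self hV w
  -- Writing `T` for the multiplier, `⟨w, V w⟩ = ⟨1, V w⟩ + lam ⟨T(V w), V w⟩`; the left side and
  -- the last term are real.
  nth_rewrite 1 [hw] at h1
  rw [map_add, map_smul, inner_add_left, inner_smul_left, Complex.add_im, Complex.mul_im,
    e.im_inner_multiplier ha] at h1
  rw [e.coeffs_eq_inner ho]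
  simpa using h1

/-- Along a continuous family of Hermitian multipliers, the scalar equation for the mean of
`V w` has a solution. -/
theorem exists_solution_with_mean [Nonempty X] {o : ι} (ho : e.fn o = 1) {τ lam : ℝ}
    (hτ : 0 ≤ τ) (hτ1 : τ ≤ 1)
    {a : ℝ → SquareSummable ι} (hcont : ContinuousOn a (Set.Icc (1 - τ) (1 + τ)))
    (ha : ∀ s n, (a s n).im = 0)
    {V : C(X, ℂ)} (hV : ∀ x : X, (V x).im = 0) (hVτ : 2 * ‖V‖ ≤ τ)
    (hsmall : ∀ s ∈ Set.Icc (1 - τ) (1 + τ), |lam| * ‖a s‖ * ‖V‖ ≤ 1 / 2) :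
    ∃ s ∈ Set.Icc (1 - τ) (1 + τ), ∃ w : C(X, ℂ), w ≠ 0 ∧
      w = 1 + (lam : ℂ) • e.multiplier (a s) (V * w) ∧
      e.coeffs (V * w) o = ((s ^ 2 - 1 : ℝ) : ℂ) := by
  let A : ℝ → C(X, ℂ) →L[ℂ] C(X, ℂ) := fun s =>
    (lam : ℂ) • (e.multiplier (a s) ∘L ContinuousLinearMap.mul ℂ C(X, ℂ) V)
  have hA : ∀ s ∈ Set.Icc (1 - τ) (1 + τ), ‖A s‖ < 1 := by
    intro s hs
    refine lt_of_le_of_lt (ContinuousLinearMap.opNorm_le_bound _ (by norm_num) fun f => ?_)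
      (by norm_num : (1 : ℝ) / 2 < 1)
    change ‖(lam : ℂ) • e.multiplier (a s) (V * f)‖ ≤ _
    rw [norm_smul, Complex.norm_real, Real.norm_eq_abs]
    calc _ ≤ |lam| * (‖a s‖ * (‖V‖ * ‖f‖)) := by
          gcongr
          exact (e.norm_multiplier_apply_le _ _).trans (by gcongr; exact norm_mul_le _ _)
      _ = (|lam| * ‖a s‖ * ‖V‖) * ‖f‖ := by ring
      _ ≤ _ := by gcongr; exact hsmall s hs
  have hAcont : ContinuousOn A (Set.Icc (1 - τ) (1 + τ)) := by
    have : ContinuousOn (fun s => e.multiplier (a s)) (Set.Icc (1 - τ) (1 + τ)) :=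
      e.continuous_multiplier.comp_continuousOn hcont
    fun_prop
  have hunit : ∀ s ∈ Set.Icc (1 - τ) (1 + τ), IsUnit (1 - A s) := fun s hs =>
    ⟨Units.oneSub (A s) (hA s hs), rfl⟩
  -- Continuity of inversion at units makes `w` continuous in `s`.
  let w : ℝ → C(X, ℂ) := fun s => Ring.inverse (1 - A s) 1
  have hw : ∀ s ∈ Set.Icc (1 - τ) (1 + τ),
      w s = 1 + (lam : ℂ) • e.multiplier (a s) (V * w s) := by
    intro s hs
    have h := congrArg (fun B : C(X, ℂ) →L[ℂ] C(X, ℂ) => B 1)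
      (Ring.mul_inverse_cancel _ (hunit s hs))
    change w s - (lam : ℂ) • e.multiplier (a s) (V * w s) = 1 at h
    rw [← h, sub_add_cancel]
  have hwcont : ContinuousOn w (Set.Icc (1 - τ) (1 + τ)) := by
    have : ContinuousOn (fun s => Ring.inverse (1 - A s)) (Set.Icc (1 - τ) (1 + τ)) := by
      intro s hs
      obtain ⟨u, hu⟩ := hunit s hs
      have h1 := NormedRing.inverse_continuousAt
        (R := C(X, ℂ) →L[ℂ] C(X, ℂ)) u
      rw [hu] at h1
      exact h1.comp_continuousWithinAt (f := fun s => 1 - A s)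
        (continuousWithinAt_const.sub (hAcont s hs))
    exact this.clm_apply continuousOn_const
  have hmeancont : ContinuousOn (fun s => s ^ 2 - 1 - (e.coeffs (V * w s) o).re)
      (Set.Icc (1 - τ) (1 + τ)) := by
    have h1 : Continuous fun f : C(X, ℂ) => (e.coeffs (V * f) o).re :=
      Complex.continuous_re.comp ((lp.evalCLM ℂ (fun _ : ι => ℂ) 2 o).continuous.comp
        (e.coeffs.continuous.comp (continuous_const.mul continuous_id)))
    exact ((continuous_pow 2).sub continuous_const).continuousOn.sub
      (h1.comp_continuousOn hwcont)
  have hmean : ∀ s ∈ Set.Icc (1 - τ) (1 + τ), |(e.coeffs (V * w s) o).re| ≤ τ := by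
    intro s hs
    calc _ ≤ ‖e.coeffs (V * w s) o‖ := Complex.abs_re_le_norm _
      _ ≤ ‖e.coeffs (V * w s)‖ := lp.norm_apply_le_norm (by norm_num) _ _
      _ ≤ ‖V * w s‖ := e.norm_coeffs_le _
      _ ≤ ‖V‖ * ‖w s‖ := norm_mul_le _ _
      _ ≤ ‖V‖ * 2 := by gcongr; exact e.norm_solution_le_two (hsmall s hs) (hw s hs)
      _ ≤ τ := by linarith
  have hl : 1 - τ ∈ Set.Icc (1 - τ) (1 + τ) := ⟨le_rfl, by linarith⟩
  have hr : 1 + τ ∈ Set.Icc (1 - τ) (1 + τ) := ⟨by linarith, le_rfl⟩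
  -- Since `τ ≤ 1`, `s² - 1` is at most `-τ` at the left end and at least `τ` at the right end,
  -- while the mean stays in `[-τ, τ]`.
  have h0 : (0 : ℝ) ∈ Set.Icc
      ((1 - τ) ^ 2 - 1 - (e.coeffs (V * w (1 - τ)) o).re)
      ((1 + τ) ^ 2 - 1 - (e.coeffs (V * w (1 + τ)) o).re) := by
    have h1 := abs_le.mp (hmean _ hl)
    have h2 := abs_le.mp (hmean _ hr)
    constructor <;> nlinarith
  obtain ⟨s, hs, hs0⟩ := intermediate_value_Icc (by linarith) hmeancont h0
  refine ⟨s, hs, w s, ?_, hw s hs, ?_⟩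
  · intro h
    have h1 := hw s hs
    rw [h, mul_zero, map_zero] at h1
    have h2 := congrArg norm h1
    rw [norm_zero, show (lam : ℂ) • (0 : C(X, ℂ)) = 0 from smul_zero _,
      add_zero, norm_one] at h2
    exact zero_ne_one h2
  · apply Complex.ext
    · rw [Complex.ofReal_re]
      simp only at hs0
      linarith
    · rw [e.im_mean_eq_zero ho (ha s) hV (hw s hs), Complex.ofReal_im]

end ContinuousHilbertBasis

end FourierMultipliers

/-! ### Plane waves as weak eigenfunctions of the Laplacian -/

noncomputable section PlaneWaves

open scoped FourierTransform

/-- The plane wave `x ↦ exp(i k·x)`. -/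
def planeWave (k x : Plane) : ℂ := Complex.exp ((inner ℝ k x : ℝ) * Complex.I)

@[fun_prop]
lemma continuous_planeWave (k : Plane) : Continuous (planeWave k) := by
  unfold planeWave
  fun_prop

lemma norm_planeWave (k x : Plane) : ‖planeWave k x‖ = 1 := Complex.norm_exp_ofReal_mul_I _

lemma integrable_laplacian {φ : Plane → ℂ} (hφ : ContDiff ℝ ∞ φ) (hc : HasCompactSupport φ) :
    Integrable (Δ φ) volume := by
  have : (Δ φ) = ⇑(Δ (hc.toSchwartzMap hφ) : SchwartzMap Plane ℂ) := by
    ext x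
    rw [SchwartzMap.laplacian_apply]
    rfl
  rw [this]
  exact SchwartzMap.integrable _

/-- The integral is a Fourier transform at `-k/(2π)`, where the Laplacian acts as multiplication by
`-|k|²`. -/
lemma integral_planeWave_mul_laplacian (k : Plane) {φ : Plane → ℂ} (hφ : ContDiff ℝ ∞ φ)
    (hc : HasCompactSupport φ) :
    ∫ x, planeWave k x * Δ φ x = -((‖k‖ ^ 2 : ℝ) : ℂ) * ∫ x, planeWave k x * φ x := by
  let f := hc.toSchwartzMap hφ
  have hpi := Real.pi_pos
  have key : ∀ g : SchwartzMap Plane ℂ,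
      𝓕 g ((-(2 * Real.pi)⁻¹) • k) = ∫ x, planeWave k x * g x := by
    intro g
    rw [SchwartzMap.fourier_coe, Real.fourier_eq']
    congr 1
    ext x
    rw [smul_eq_mul, planeWave, inner_smul_right, real_inner_comm]
    congr 4
    field_simp
  have h1 := congrArg (fun g : SchwartzMap Plane ℂ => 𝓕 g ((-(2 * Real.pi)⁻¹) • k))
    (SchwartzMap.laplacian_eq_fourierMultiplierCLM f)
  simp only at h1
  rw [FourierTransform.fourier_smul, SchwartzMap.fourierMultiplierCLM_apply,
    FourierTransform.fourier_fourierInv_eq, smul_apply,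
    SchwartzMap.smulLeftCLM_apply_apply (by fun_prop), key, key] at h1
  have h2 : ∀ x, (Δ f) x = Δ φ x := fun x => SchwartzMap.laplacian_apply f x
  simp_rw [h2] at h1
  rw [h1, smul_smul, Complex.real_smul]
  congr 1
  rw [← Complex.ofReal_neg]
  congr 1
  rw [norm_smul, mul_pow ‖_‖, Real.norm_eq_abs, sq_abs]
  field_simp

end PlaneWaves

/-! ### From the reduced equation to Bloch waves -/

noncomputable section BlochWaves

variable {X ι : Type*} [TopologicalSpace X] [CompactSpace X] {p : Plane → X}

lemma integrable_comp_mul (hp : Continuous p) {ψ : Plane → ℂ} (hψ : Integrable ψ volume)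
    (h : C(X, ℂ)) : Integrable (fun x => h (p x) * ψ x) volume :=
  hψ.bdd_mul (h.continuous.comp hp).aestronglyMeasurable
    (.of_forall fun x => h.norm_coe_le_norm (p x))

/-- Testing the pull-back of a continuous function along `p` against an integrable function. -/
def testFunctional (hp : Continuous p) {ψ : Plane → ℂ} (hψ : Integrable ψ volume) :
    C(X, ℂ) →L[ℂ] ℂ :=
  LinearMap.mkContinuous
    { toFun := fun h => ∫ x, h (p x) * ψ x
      map_add' := fun h g => by
        rw [← integral_add (integrable_comp_mul hp hψ h) (integrable_comp_mul hp hψ g)]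
        simp [add_mul]
      map_smul' := fun c h => by
        simp [mul_assoc, integral_const_mul] }
    (∫ x, ‖ψ x‖) (fun h => by
      rw [mul_comm, ← integral_const_mul]
      refine norm_integral_le_of_norm_le (hψ.norm.const_mul _) (.of_forall fun x => ?_)
      rw [norm_mul]
      gcongr
      exact h.norm_coe_le_norm (p x))

lemma testFunctional_apply (hp : Continuous p) {ψ : Plane → ℂ} (hψ : Integrable ψ volume)
    (h : C(X, ℂ)) : testFunctional hp hψ h = ∫ x, h (p x) * ψ x := rfl

lemma integrable_planeWave_mul (k : Plane) {ψ : Plane → ℂ} (hψ : Integrable ψ volume) :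
    Integrable (fun x => planeWave k x * ψ x) volume :=
  hψ.bdd_mul (continuous_planeWave k).aestronglyMeasurable
    (.of_forall fun x => (norm_planeWave k x).le)

variable [MeasurableSpace X] [BorelSpace X] {μ : Measure X} [IsProbabilityMeasure μ]
  [DecidableEq ι] (e : ContinuousHilbertBasis ι μ)

/-- The multiplier with symbol `(|κₙ|² - lam)⁻¹`, `n ≠ o`, inverts `-Δ - lam` up to the mode
`o`. -/
lemma testFunctional_multiplier {o : ι} (ho : e.fn o = 1)
    (hd : Dense (Submodule.span ℂ (Set.range e.fn) : Set C(X, ℂ)))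
    (hp : Continuous p) {θ : Plane} {κ : ι → Plane}
    (hκ : ∀ n x, planeWave θ x * e.fn n (p x) = planeWave (κ n) x) {lam : ℝ}
    {a : SquareSummable ι} (ha : ∀ n, n ≠ o → a n * ((‖κ n‖ ^ 2 - lam : ℝ) : ℂ) = 1)
    (ha0 : a o = 0) {φ : Plane → ℂ} (hφ : ContDiff ℝ ∞ φ) (hc : HasCompactSupport φ)
    (h1 : Integrable (fun x => planeWave θ x * Δ φ x) volume)
    (h2 : Integrable (fun x => planeWave θ x * φ x) volume) (h : C(X, ℂ)) :
    -testFunctional hp h1 (e.multiplier a h) - lam * testFunctional hp h2 (e.multiplier a h) =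
      testFunctional hp h2 h - e.coeffs h o * testFunctional hp h2 1 := by
  let c : C(X, ℂ) →L[ℂ] ℂ := (lp.evalCLM ℂ (fun _ : ι => ℂ) 2 o) ∘L e.coeffs
  let A : C(X, ℂ) →L[ℂ] ℂ := -(testFunctional hp h1 ∘L e.multiplier a) -
    (lam : ℂ) • (testFunctional hp h2 ∘L e.multiplier a)
  let B : C(X, ℂ) →L[ℂ] ℂ := testFunctional hp h2 - (testFunctional hp h2 1) • c
  -- Both sides are continuous and linear in `h`, so basis functions suffice. These become plane
  -- waves, and on the mode `o` both sides vanish.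
  have hAB : A = B := by
    refine ContinuousLinearMap.ext_on hd ?_
    rintro _ ⟨n, rfl⟩
    change -testFunctional hp h1 (e.multiplier a (e.fn n)) -
      (lam : ℂ) * testFunctional hp h2 (e.multiplier a (e.fn n)) =
      testFunctional hp h2 (e.fn n) - testFunctional hp h2 1 * e.coeffs (e.fn n) o
    rw [e.multiplier_fn, map_smul, map_smul, e.coeffs_fn_apply]
    have e1 : testFunctional hp h1 (e.fn n) =
        -((‖κ n‖ ^ 2 : ℝ) : ℂ) * testFunctional hp h2 (e.fn n) := by
      rw [testFunctional_apply, testFunctional_apply]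
      simp_rw [← mul_assoc, mul_comm (e.fn n _), hκ]
      exact integral_planeWave_mul_laplacian (κ n) hφ hc
    rw [e1]
    by_cases hn : n = o
    · subst hn
      simp [ha0, ho]
    · rw [if_neg (Ne.symm hn), smul_eq_mul, smul_eq_mul]
      have := ha n hn
      push_cast at this ⊢
      linear_combination (testFunctional hp h2 (e.fn n)) * this
  have := congrArg (fun L : C(X, ℂ) →L[ℂ] ℂ => L h) hAB
  change -testFunctional hp h1 (e.multiplier a h) -
      (lam : ℂ) * testFunctional hp h2 (e.multiplier a h) =
      testFunctional hp h2 h - testFunctional hp h2 1 * e.coeffs h o at this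
  rw [this, mul_comm (e.coeffs h o)]

/-- Solutions of the reduced equation on `X` give Bloch waves. -/
theorem isDistributionalSolution_bloch {o : ι} (ho : e.fn o = 1)
    (hd : Dense (Submodule.span ℂ (Set.range e.fn) : Set C(X, ℂ)))
    (hp : Continuous p) {θ : Plane} {κ : ι → Plane}
    (hκ : ∀ n x, planeWave θ x * e.fn n (p x) = planeWave (κ n) x) {lam : ℝ}
    {a : SquareSummable ι} (ha : ∀ n, n ≠ o → a n * ((‖κ n‖ ^ 2 - lam : ℝ) : ℂ) = 1)
    (ha0 : a o = 0) {V w : C(X, ℂ)} (hw : w = 1 + (lam : ℂ) • e.multiplier a (V * w))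
    (hmean : lam * e.coeffs (V * w) o = ((‖θ‖ ^ 2 - lam : ℝ) : ℂ))
    {ε : Plane → ℝ} (hε : ∀ x, (ε x : ℂ) = 1 + V (p x)) :
    IsDistributionalSolution ε lam (fun x => planeWave θ x * w (p x)) := by
  refine ⟨Continuous.locallyIntegrable (by fun_prop), fun φ hφ hc => ?_⟩
  have h1 := integrable_planeWave_mul θ (integrable_laplacian hφ hc)
  have h2 := integrable_planeWave_mul θ (hφ.continuous.integrable_of_hasCompactSupport hc)
  have e1 : ∫ x, planeWave θ x * w (p x) * Δ φ x = testFunctional hp h1 w := by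
    rw [testFunctional_apply]
    congr 1; ext x; ring
  have e2 : ∫ x, (ε x : ℂ) * (planeWave θ x * w (p x)) * φ x =
      testFunctional hp h2 w + testFunctional hp h2 (V * w) := by
    rw [← map_add, testFunctional_apply]
    congr 1; ext x
    rw [hε, ContinuousMap.add_apply, ContinuousMap.mul_apply]
    ring
  have e3 : testFunctional hp h1 (1 : C(X, ℂ)) =
      -((‖θ‖ ^ 2 : ℝ) : ℂ) * testFunctional hp h2 (1 : C(X, ℂ)) := by
    rw [testFunctional_apply, testFunctional_apply]
    simp only [ContinuousMap.one_apply, one_mul]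
    exact integral_planeWave_mul_laplacian θ hφ hc
  have e4 := testFunctional_multiplier e ho hd hp hκ ha ha0 hφ hc h1 h2 (V * w)
  have e5 : testFunctional hp h1 w = testFunctional hp h1 (1 : C(X, ℂ)) +
      lam * testFunctional hp h1 (e.multiplier a (V * w)) := by
    nth_rewrite 1 [hw]
    rw [map_add, map_smul, smul_eq_mul]
  have e6 : testFunctional hp h2 w = testFunctional hp h2 (1 : C(X, ℂ)) +
      lam * testFunctional hp h2 (e.multiplier a (V * w)) := by
    nth_rewrite 1 [hw]
    rw [map_add, map_smul, smul_eq_mul]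
  rw [e1, e2, e5, e6, e3]
  push_cast at hmean ⊢
  -- `e4` settles the nonzero modes; its defect in the mode `o` is cancelled by `hmean`.
  linear_combination (lam : ℂ) * e4 - testFunctional hp h2 (1 : C(X, ℂ)) * hmean

end BlochWaves

/-! ### The torus, the resolvent symbol and the conclusion -/

noncomputable section TorusBasis

open UnitAddTorus

attribute [local instance] instMeasureSpaceUnitAddCircle

local instance : IsProbabilityMeasure (volume : Measure UnitAddCircle) :=
  inferInstanceAs (IsProbabilityMeasure AddCircle.haarAddCircle)

/-- The trigonometric monomials on the two-dimensional torus. -/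
def torusBasis :
    ContinuousHilbertBasis (Fin 2 → ℤ) (volume : Measure (UnitAddTorus (Fin 2))) where
  fn := mFourier
  basis := mFourierBasis
  basis_eq n := by rw [coe_mFourierBasis]
  norm_fn _ := mFourier_norm

lemma dense_span_torusBasis : Dense
    (Submodule.span ℂ (Set.range torusBasis.fn) : Set C(UnitAddTorus (Fin 2), ℂ)) := by
  rw [Submodule.dense_iff_topologicalClosure_eq_top]
  exact span_mFourier_closure_eq_top

/-- The projection `ℝ² → ℝ² / ℤ²`. -/
def toTorus (x : Plane) : UnitAddTorus (Fin 2) := fun i => (x i : UnitAddCircle)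

lemma isOpenQuotientMap_toTorus : IsOpenQuotientMap toTorus := by
  have h1 : IsOpenQuotientMap (Pi.map fun (_ : Fin 2) (t : ℝ) => (t : UnitAddCircle)) :=
    .piMap fun _ => QuotientAddGroup.isOpenQuotientMap_mk
  exact h1.comp (EuclideanSpace.equiv (Fin 2) ℝ).toHomeomorph.isOpenQuotientMap

lemma continuous_toTorus : Continuous toTorus := isOpenQuotientMap_toTorus.continuous

lemma IsZ2Periodic.factorsThrough {f : Plane → ℝ} (hf : IsZ2Periodic f) :
    Function.FactorsThrough f toTorus := by
  intro x y hxy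
  have h : ∀ i, ∃ m : ℤ, x i - y i = m := by
    intro i
    have h1 : ((x i - y i : ℝ) : UnitAddCircle) = 0 := by
      rw [AddCircle.coe_sub, sub_eq_zero]
      exact congrFun hxy i
    obtain ⟨m, hm⟩ := (AddCircle.coe_eq_zero_iff (1 : ℝ)).mp h1
    exact ⟨m, by rw [← hm]; simp⟩
  choose m hm using h
  rw [← hf m y]
  congr 1
  ext i
  simp [← hm i]

/-- The lift of `ε - 1` to the torus. -/
lemma exists_torus_perturbation {ε : Plane → ℝ} (hε : Continuous ε) (hper : IsZ2Periodic ε)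
    {δ : ℝ} (hδ : 0 ≤ δ) (hbound : ∀ x, |ε x - 1| ≤ δ) :
    ∃ V : C(UnitAddTorus (Fin 2), ℂ), (∀ x, (ε x : ℂ) = 1 + V (toTorus x)) ∧
      (∀ z, (V z).im = 0) ∧ ‖V‖ ≤ δ := by
  have hq : Topology.IsQuotientMap (⟨toTorus, continuous_toTorus⟩ : C(Plane, _)) :=
    isOpenQuotientMap_toTorus.isQuotientMap
  let g : C(Plane, ℂ) := ⟨fun x => ((ε x - 1 : ℝ) : ℂ), by fun_prop⟩
  have hg : Function.FactorsThrough g (⟨toTorus, continuous_toTorus⟩ : C(Plane, _)) := by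
    intro x y hxy
    change ((ε x - 1 : ℝ) : ℂ) = ((ε y - 1 : ℝ) : ℂ)
    rw [hper.factorsThrough hxy]
  let V := hq.lift g hg
  have hV : ∀ x, V (toTorus x) = ((ε x - 1 : ℝ) : ℂ) := fun x =>
    congrArg (fun f : C(Plane, ℂ) => f x) (hq.lift_comp g hg)
  have hsurj : Function.Surjective toTorus := isOpenQuotientMap_toTorus.surjective
  refine ⟨V, fun x => by rw [hV]; push_cast; ring, fun z => ?_, ?_⟩
  · obtain ⟨x, rfl⟩ := hsurj z
    rw [hV, Complex.ofReal_im]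
  · rw [ContinuousMap.norm_le _ hδ]
    intro z
    obtain ⟨x, rfl⟩ := hsurj z
    rw [hV, Complex.norm_real]
    exact hbound x

/-- The frequency `θ + 2πn`. -/
def shiftedFrequency (θ : Plane) (n : Fin 2 → ℤ) : Plane :=
  θ + WithLp.toLp 2 (fun i => 2 * Real.pi * (n i : ℝ))

lemma planeWave_mul_torusBasis (θ : Plane) (n : Fin 2 → ℤ) (x : Plane) :
    planeWave θ x * torusBasis.fn n (toTorus x) = planeWave (shiftedFrequency θ n) x := by
  have : torusBasis.fn n (toTorus x) = ∏ i, fourier (n i) ((x i : ℝ) : UnitAddCircle) := rfl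
  rw [this]
  simp_rw [fourier_coe_apply]
  rw [Fin.prod_univ_two, planeWave, planeWave, ← Complex.exp_add, ← Complex.exp_add]
  congr 1
  simp [shiftedFrequency, PiLp.inner_apply, Fin.sum_univ_two]
  ring

lemma norm_sq_shiftedFrequency {a b : ℝ} (hab : a ^ 2 + b ^ 2 = 1) (r s : ℝ) (n : Fin 2 → ℤ) :
    ‖shiftedFrequency (WithLp.toLp 2 ![s * r * a, s * r * b]) n‖ ^ 2 - r ^ 2 =
      dispersion a b r s n := by
  rw [EuclideanSpace.norm_sq_eq, Fin.sum_univ_two]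
  simp [shiftedFrequency, dispersion, latticeNormSq]
  linear_combination (s ^ 2 * r ^ 2) * hab

/-- The family `|n|⁻²`, with value zero at `n = 0`. -/
def invLatticeNormSq : SquareSummable (Fin 2 → ℤ) :=
  ⟨fun n => (((latticeNormSq n)⁻¹ : ℝ) : ℂ), by
    refine (memℓp_gen_iff (by norm_num)).mpr ?_
    simpa using summable_inv_latticeNormSq_sq⟩

lemma invLatticeNormSq_apply (n : Fin 2 → ℤ) :
    invLatticeNormSq n = (((latticeNormSq n)⁻¹ : ℝ) : ℂ) := rfl

lemma memℓp_of_norm_le_inv {f : (Fin 2 → ℤ) → ℂ} {C : ℝ}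
    (h : ∀ n, ‖f n‖ ≤ C * (latticeNormSq n)⁻¹) : Memℓp f 2 := by
  refine (memℓp_gen_iff (by norm_num)).mpr ?_
  refine Summable.of_nonneg_of_le (fun n => by positivity) (fun n => ?_)
    (summable_inv_latticeNormSq_sq.mul_left (C ^ 2))
  rw [← mul_pow]
  simpa using pow_le_pow_left₀ (norm_nonneg _) (h n) 2

lemma norm_le_of_norm_le_inv {f : SquareSummable (Fin 2 → ℤ)} {C : ℝ} (hC : 0 ≤ C)
    (h : ∀ n, ‖f n‖ ≤ C * (latticeNormSq n)⁻¹) : ‖f‖ ≤ C * ‖invLatticeNormSq‖ := by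
  have h1 : ‖((C : ℂ) • invLatticeNormSq)‖ = C * ‖invLatticeNormSq‖ := by
    rw [norm_smul, Complex.norm_real, Real.norm_of_nonneg hC]
  rw [← h1]
  refine lp.norm_mono (by norm_num) fun n => (h n).trans_eq ?_
  rw [lp.coeFn_smul, Pi.smul_apply, smul_eq_mul, invLatticeNormSq_apply, norm_mul,
    Complex.norm_real, Complex.norm_real, Real.norm_of_nonneg hC,
    Real.norm_of_nonneg (inv_nonneg.mpr (latticeNormSq_nonneg n))]

/-- A family of square-summable symbols inverting the dispersion away from `n = 0`. -/
lemma exists_resolvent_symbol {R c τ : ℝ} (hc : 0 < c) (hτ1 : τ ≤ 1) {a b r : ℝ}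
    (hab : a ^ 2 + b ^ 2 = 1) (hr : r ∈ Set.Icc 0 R)
    (hgap : ∀ s, |s - 1| ≤ τ → ∀ n : Fin 2 → ℤ, c * latticeNormSq n ≤ |dispersion a b r s n|) :
    ∃ f : ℝ → SquareSummable (Fin 2 → ℤ), (∀ s n, (f s n).im = 0) ∧ (∀ s, f s 0 = 0) ∧
      ContinuousOn f (Set.Icc (1 - τ) (1 + τ)) ∧
      ∀ s ∈ Set.Icc (1 - τ) (1 + τ), ‖f s‖ ≤ c⁻¹ * ‖invLatticeNormSq‖ ∧
        ∀ n, n ≠ 0 → f s n * (dispersion a b r s n : ℂ) = 1 := by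
  classical
  have hR : 0 ≤ R := hr.1.trans hr.2
  have hpi := Real.pi_pos
  -- Cutting off outside `|s - 1| ≤ τ` keeps the symbol square-summable for every `s`.
  let g : ℝ → (Fin 2 → ℤ) → ℂ := fun s n =>
    if n = 0 ∨ τ < |s - 1| then 0 else (((dispersion a b r s n)⁻¹ : ℝ) : ℂ)
  have hg : ∀ s n, ‖g s n‖ ≤ c⁻¹ * (latticeNormSq n)⁻¹ := by
    intro s n
    have hq := latticeNormSq_nonneg n
    by_cases h : n = 0 ∨ τ < |s - 1|
    · simp only [g, if_pos h, norm_zero]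
      positivity
    · simp only [g, if_neg h]
      push Not at h
      have hq := one_le_latticeNormSq h.1
      rw [Complex.norm_real, norm_inv, Real.norm_eq_abs, ← mul_inv]
      exact inv_anti₀ (by positivity) (hgap s h.2 n)
  let f : ℝ → SquareSummable (Fin 2 → ℤ) := fun s => ⟨g s, memℓp_of_norm_le_inv (hg s)⟩
  have hf : ∀ s n, f s n = g s n := fun _ _ => rfl
  have hmem : ∀ s ∈ Set.Icc (1 - τ) (1 + τ), |s - 1| ≤ τ := fun s hs =>
    abs_le.mpr ⟨by linarith [hs.1], by linarith [hs.2]⟩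
  have hval : ∀ s ∈ Set.Icc (1 - τ) (1 + τ), ∀ n, n ≠ 0 →
      f s n = (((dispersion a b r s n)⁻¹ : ℝ) : ℂ) ∧ dispersion a b r s n ≠ 0 := by
    intro s hs n hn
    have h1 := hgap s (hmem s hs) n
    have h2 := one_le_latticeNormSq hn
    refine ⟨?_, abs_pos.mp (lt_of_lt_of_le (by positivity) h1)⟩
    rw [hf]
    exact if_neg (by push Not; exact ⟨hn, hmem s hs⟩)
  have hzero : ∀ s, f s 0 = 0 := fun s => by
    rw [hf]
    exact if_pos (Or.inl rfl)
  refine ⟨f, fun s n => ?_, hzero, ?_, fun s hs => ⟨norm_le_of_norm_le_inv (by positivity) (hg s),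
    fun n hn => ?_⟩⟩
  · rw [hf]
    simp only [g]
    split_ifs <;> simp only [Complex.zero_im, Complex.ofReal_im]
  · set L := (4 * R ^ 2 + 4 * Real.pi * R) with hL
    have hL0 : 0 ≤ L := by positivity
    set K : ℝ := L * (c⁻¹ * c⁻¹) * ‖invLatticeNormSq‖ with hK
    have hK0 : 0 ≤ K := by positivity
    refine LipschitzOnWith.continuousOn (K := K.toNNReal) (.of_dist_le_mul fun s hs t ht => ?_)
    rw [dist_eq_norm, Real.coe_toNNReal _ hK0, Real.dist_eq]
    -- The difference of inverses has numerator `O(|s - t| |n|²)` and denominator at least `c²|n|⁴`.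
    have key : ∀ n, ‖(f s - f t) n‖ ≤ (L * |s - t| * (c⁻¹ * c⁻¹)) * (latticeNormSq n)⁻¹ := by
      intro n
      rw [lp.coeFn_sub, Pi.sub_apply]
      rcases eq_or_ne n 0 with rfl | hn
      · rw [hzero, hzero, sub_zero, norm_zero]
        have := latticeNormSq_nonneg 0
        positivity
      have hq := one_le_latticeNormSq hn
      obtain ⟨h1, h2⟩ := hval s hs n hn
      obtain ⟨h3, h4⟩ := hval t ht n hn
      have h5 := hmem s hs
      have h6 := hmem t ht
      have h7 : |s| ≤ 2 := by rw [abs_le] at h5 ⊢; constructor <;> linarith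
      have h8 : |t| ≤ 2 := by rw [abs_le] at h6 ⊢; constructor <;> linarith
      have h9 := abs_dispersion_sub_le hab hr h8 h7 hn
      rw [h1, h3, ← Complex.ofReal_sub, Complex.norm_real, Real.norm_eq_abs, inv_sub_inv h2 h4,
        abs_div, abs_mul]
      rw [abs_sub_comm t s] at h9
      calc _ ≤ L * |s - t| * latticeNormSq n / ((c * latticeNormSq n) * (c * latticeNormSq n)) := by
            gcongr
            · exact hgap s h5 n
            · exact hgap t h6 n
        _ = _ := by field_simp
    refine (norm_le_of_norm_le_inv (by positivity) key).trans_eq ?_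
    rw [hK]
    ring
  · obtain ⟨h1, h2⟩ := hval s hs n hn
    rw [h1, ← Complex.ofReal_mul, inv_mul_cancel₀ h2, Complex.ofReal_one]

theorem theorem3 :
    ∀ Λ : ℝ, 0 < Λ → ∃ δ : ℝ, 0 < δ ∧
      ∀ ε : Plane → ℝ, Continuous ε → (∀ x, 0 < ε x) → IsZ2Periodic ε →
        (∀ x, |ε x - 1| < δ) →
        ∀ lam : ℝ, 0 ≤ lam → lam ≤ Λ →
          ∃ E : Plane → ℂ, Continuous E ∧ (∃ C : ℝ, ∀ x, ‖E x‖ ≤ C) ∧ (∃ x, E x ≠ 0) ∧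
            IsDistributionalSolution ε lam E := by
  intro Λ hΛ
  obtain ⟨c, hc, τ, hτ, hτ1, hgap⟩ := exists_dispersion_gap (Real.sqrt_nonneg Λ)
  set M := Λ * (c⁻¹ * ‖invLatticeNormSq‖) with hM
  have hM0 : 0 ≤ M := by positivity
  -- The first bound gives `2‖V‖ ≤ τ`; the second gives contraction factor at most `1/2`, as `M`
  -- bounds `lam ‖f s‖`.
  refine ⟨min (τ / 2) (1 / (2 * (M + 1))), by positivity, ?_⟩
  intro ε hε _ hper hδ lam hlam hlamΛ
  obtain ⟨V, hVε, hVim, hVnorm⟩ := exists_torus_perturbation hε hper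
    (δ := min (τ / 2) (1 / (2 * (M + 1)))) (by positivity) fun x => (hδ x).le
  have hr : √lam ∈ Set.Icc 0 √Λ := ⟨Real.sqrt_nonneg _, Real.sqrt_le_sqrt hlamΛ⟩
  obtain ⟨a, b, hab, hgap⟩ := hgap _ hr
  obtain ⟨f, hfim, hf0, hfcont, hf⟩ := exists_resolvent_symbol hc hτ1 hab hr hgap
  have ho : torusBasis.fn 0 = 1 := UnitAddTorus.mFourier_zero
  obtain ⟨s, hs, w, hw0, hw, hmean⟩ := torusBasis.exists_solution_with_mean ho hτ.le hτ1 hfcont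
    hfim hVim (lam := lam) (by linarith [hVnorm.trans (min_le_left _ _)]) (by
      intro s hs
      have h1 := hVnorm.trans (min_le_right _ _)
      have h2 : |lam| * ‖f s‖ ≤ M := by
        rw [abs_of_nonneg hlam]
        exact mul_le_mul hlamΛ (hf s hs).1 (norm_nonneg _) hΛ.le
      calc _ ≤ M * (1 / (2 * (M + 1))) := by gcongr
        _ ≤ 1 / 2 := by
          rw [mul_one_div, div_le_div_iff₀ (by positivity) (by norm_num)]
          linarith)
  set θ : Plane := WithLp.toLp 2 ![s * √lam * a, s * √lam * b] with hθ
  have hsq : √lam ^ 2 = lam := Real.sq_sqrt hlam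
  have hθnorm : ‖θ‖ ^ 2 = s ^ 2 * lam := by
    rw [EuclideanSpace.norm_sq_eq, Fin.sum_univ_two, hθ]
    simp [sq_abs, mul_pow]
    linear_combination (s ^ 2 * √lam ^ 2) * hab + s ^ 2 * hsq
  refine ⟨fun x => planeWave θ x * w (toTorus x), ?_, ⟨‖w‖, fun x => ?_⟩, ?_, ?_⟩
  · exact (continuous_planeWave θ).mul (w.continuous.comp continuous_toTorus)
  · rw [norm_mul, norm_planeWave, one_mul]
    exact w.norm_coe_le_norm _
  · by_contra! h
    apply hw0
    ext z
    obtain ⟨x, rfl⟩ := isOpenQuotientMap_toTorus.surjective z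
    have h1 := h x
    rw [mul_eq_zero] at h1
    exact h1.resolve_left (Complex.exp_ne_zero _)
  · refine isDistributionalSolution_bloch torusBasis ho dense_span_torusBasis continuous_toTorus
      (planeWave_mul_torusBasis θ) (fun n hn => ?_) (hf0 s) hw ?_ hVε
    · have h1 := norm_sq_shiftedFrequency hab (√lam) s n
      rw [hsq] at h1
      rw [h1]
      exact (hf s hs).2 n hn
    -- The zero mode: `lam (s² - 1) = |θ|² - lam`, valid for `lam = 0` too.
    · rw [hmean, hθnorm]
      push_cast
      ring

end TorusBasis
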